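/- Throughout, graphs are finite, simple and undirected, and $d_\Gamma$ denotes the distance in a connected graph $\Gamma$. A connected graph $\Gamma$ of diameter $D$ is distance-regular with intersection array $A=(b_0,\dots,b_{D-1};c_1,\dots,c_D)$ if for every $i\in\{0,\dots,D\}$ and all vertices $x,y$ with $d_\Gamma(x,y)=i$ exactly $b_i$ neighbours of $y$ are at distance $i+1$ from $x$ and exactly $c_i$ neighbours of $y$ are at distance $i-1$ from $x$, where $b_D=c_0=0$ (and every vertex has some vertex at distance $D$ from it); put $k=b_0$ and $a_i=k-b_i-c_i$. An eigenfunction of $\Gamma$ with eigenvalue $\theta$ is a function $f:V(\Gamma)\to\mathbb{R}$, $f\not\equiv 0$, with $\sum_{y\sim x}f(y)=\theta f(x)$ for all vertices $x$. If $\Gamma$ is distance-regular with intersection array $A$, such an $f$ meets the weight-distribution (w.d.) bound if it has exactly $\sum_{i=0}^{D}|W^i_{A,\theta}|$ nonzeros, where $W^0_{A,\theta}=1$, $W^1_{A,\theta}=\theta$ and $W^i_{A,\theta}=\big((\theta-a_{i-1})W^{i-1}_{A,\theta}-b_{i-2}W^{i-2}_{A,\theta}\big)/c_i$ for $i\ge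 2$. A $(k,s,m)$ pair $(\Gamma,S)$ consists of a connected $k$-regular graph $\Gamma$ and a set $S$ of $(s+1)$-cliques of $\Gamma$ such that every edge of $\Gamma$ lies in exactly $m\ge 1$ cliques from $S$. It is a Delsarte pair if $\Gamma$ is distance-regular and every clique in $S$ has cardinality $1-k/\theta_{\min}$, where $\theta_{\min}$ is the minimum eigenvalue of $\Gamma$. A clique bitrade in $\Gamma$ is a pair $(T_0,T_1)$ of disjoint nonempty sets of vertices such that, for some $(k,s,m)$ pair $(\Gamma,S)$, every clique from $S$ either intersects each of $T_0$, $T_1$ in exactly one vertex or intersects neither of them. It meets the w.d. bound if the function equal to $1$ on $T_0$, $-1$ on $T_1$ and $0$ elsewhere is an eigenfunction of $\Gamma$ that meets the w.d. bound. A subgraph $H$ of $\Gamma$ is isometric if it is connected and $d_H(x,y)=d_\Gamma(x,y)$ for all vertices $x,y$ of $H$. **Statement.** For every sequence $A=(b_0,\dots,b_{D-1};c_1,\dots,c_D)$ of non-negative integers there is a sequence $A'=(b'_0,\dots,b'_{D-1};c'_1,\dots,c'_D)$ of non-negative integers, depending only on $A$, such that for every distance-regular graph $\Gamma$ with at least two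 vertices and with intersection array $A$ that admits a Delsarte pair, the following are equivalent: 1. $\Gamma$ has a clique bitrade meeting the w.d. bound; 2. $\Gamma$ has an isometric subgraph that is distance-regular with intersection array $A'$. In particular, for every distance-regular graph $\Gamma$ with at least two vertices admitting a Delsarte pair there is a sequence $A'$, of the same length as the intersection array of $\Gamma$, for which (1) and (2) are equivalent. -/

import Mathlib

universe u

/-- A sequence `(b_0, …, b_{D-1}; c_1, …, c_D)` of natural numbers; `c j` stores `c_{j+1}`. -/
@[ext]
structure IntersectionArray (D : ℕ) where
  /-- The numbers `b_0, …, b_{D-1}`. -/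
  b : Fin D → ℕ
  /-- The numbers `c_1, …, c_D`. -/
  c : Fin D → ℕ

namespace IntersectionArray

variable {D : ℕ}

/-- The number `b_i`, with `b_i = 0` for `i ≥ D`. -/
def bAt (A : IntersectionArray D) (i : ℕ) : ℕ :=
  if h : i < D then A.b ⟨i, h⟩ else 0

/-- The number `c_i`, with `c_0 = 0` (and `c_i = 0` for `i > D`). -/
def cAt (A : IntersectionArray D) (i : ℕ) : ℕ :=
  if h : 0 < i ∧ i ≤ D then A.c ⟨i - 1, by omega⟩ else 0

/-- The number `a_i = k - b_i - c_i`, where `k = b_0` is the degree. -/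
def aAt (A : IntersectionArray D) (i : ℕ) : ℝ :=
  (A.bAt 0 : ℝ) - A.bAt i - A.cAt i

/-- The coefficients `W^i_{A,θ}` of the weight distribution of an eigenfunction with
eigenvalue `θ`. -/
noncomputable def wdCoeff (A : IntersectionArray D) (θ : ℝ) : ℕ → ℝ
  | 0 => 1
  | 1 => θ
  | i + 2 => ((θ - A.aAt (i + 1)) * wdCoeff A θ (i + 1) - A.bAt i * wdCoeff A θ i)
      / A.cAt (i + 2)

end IntersectionArray

namespace SimpleGraph

variable {V : Type*}

/-- The `i`th neighborhood `Γ_i(x)` of the vertex `x`. -/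
def distSphere (Γ : SimpleGraph V) (i : ℕ) (x : V) : Set V :=
  {y | Γ.dist x y = i}

/-- `Γ` is a distance-regular graph with diameter `D` and intersection array `A`: it is connected
and every singleton `{x}` is completely regular with covering radius `D` and intersection
array `A`. -/
structure HasIntersectionArray (Γ : SimpleGraph V) {D : ℕ} (A : IntersectionArray D) : Prop where
  connected : Γ.Connected
  sphere_nonempty : ∀ x, (Γ.distSphere D x).Nonempty
  sphere_succ_eq_empty : ∀ x, Γ.distSphere (D + 1) x = ∅
  card_b : ∀ x, ∀ i ≤ D, ∀ y ∈ Γ.distSphere i x,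
    (Γ.distSphere (i + 1) x ∩ Γ.neighborSet y).encard = A.bAt i
  card_c : ∀ x, ∀ i ≤ D, ∀ y ∈ Γ.distSphere i x,
    ({z | Γ.dist x z + 1 = i} ∩ Γ.neighborSet y).encard = A.cAt i

/-- `Γ` is distance-regular. -/
def IsDistanceRegular (Γ : SimpleGraph V) : Prop :=
  ∃ (D : ℕ) (A : IntersectionArray D), Γ.HasIntersectionArray A

open Classical in
/-- `f` is an eigenfunction of `Γ` with eigenvalue `θ`. -/
def IsEigenfunction [Fintype V] (Γ : SimpleGraph V) (f : V → ℝ) (θ : ℝ) : Prop :=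
  f ≠ 0 ∧ ∀ x, ∑ y with Γ.Adj x y, f y = θ * f x

/-- `θ` is the minimum eigenvalue of `Γ`. -/
def IsMinEigenvalue [Fintype V] (Γ : SimpleGraph V) (θ : ℝ) : Prop :=
  IsLeast {μ : ℝ | ∃ f : V → ℝ, Γ.IsEigenfunction f μ} θ

/-- `C` is a Delsarte clique of the graph `Γ` of degree `k`: a clique with
`1 - k / θ_min` vertices. -/
def IsDelsarteClique [Fintype V] (Γ : SimpleGraph V) (k : ℕ) (C : Finset V) : Prop :=
  Γ.IsClique (C : Set V) ∧ ∃ θ : ℝ, Γ.IsMinEigenvalue θ ∧ (C.card : ℝ) = 1 - k / θ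

/-- `(Γ, S)` is a `(k, s, m)` pair: `Γ` is a connected regular graph of degree `k`, and `S` is a
set of `(s + 1)`-cliques such that every edge of `Γ` lies in exactly `m` of them, `m ≥ 1`. -/
structure IsCliquePair (Γ : SimpleGraph V) (k s m : ℕ) (S : Set (Finset V)) : Prop where
  connected : Γ.Connected
  regular : ∀ x, (Γ.neighborSet x).encard = k
  m_pos : 0 < m
  isNClique : ∀ C ∈ S, Γ.IsNClique (s + 1) C
  card_edge : ∀ x y, Γ.Adj x y → {C ∈ S | x ∈ C ∧ y ∈ C}.encard = m

/-- `(Γ, S)` is a Delsarte pair with parameters `(k, s, m)`. -/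
structure IsDelsartePair [Fintype V] (Γ : SimpleGraph V) (k s m : ℕ) (S : Set (Finset V)) :
    Prop where
  isCliquePair : Γ.IsCliquePair k s m S
  isDistanceRegular : Γ.IsDistanceRegular
  isDelsarteClique : ∀ C ∈ S, Γ.IsDelsarteClique k C

/-- `(T₀, T₁)` is an `S`-bitrade: `T₀` and `T₁` are disjoint nonempty sets of vertices, and every
clique from `S` either meets each of them in exactly one vertex or meets neither of them. -/
structure IsBitrade (S : Set (Finset V)) (T₀ T₁ : Set V) : Prop where
  nonempty_left : T₀.Nonempty
  nonempty_right : T₁.Nonempty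
  disjoint : Disjoint T₀ T₁
  inter : ∀ C ∈ S,
    ((∃! x, x ∈ C ∧ x ∈ T₀) ∧ (∃! x, x ∈ C ∧ x ∈ T₁)) ∨
      (Disjoint (C : Set V) T₀ ∧ Disjoint (C : Set V) T₁)

/-- `(T₀, T₁)` is a clique bitrade in `Γ`: an `S`-bitrade for some `(k, s, m)` pair `(Γ, S)`. -/
def IsCliqueBitrade (Γ : SimpleGraph V) (T₀ T₁ : Set V) : Prop :=
  ∃ (k s m : ℕ) (S : Set (Finset V)), Γ.IsCliquePair k s m S ∧ IsBitrade S T₀ T₁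

/-- The function that is `1` on `T₀`, `-1` on `T₁` and `0` elsewhere (`T₀`, `T₁` disjoint). -/
noncomputable def bitradeFun (T₀ T₁ : Set V) : V → ℝ :=
  T₀.indicator 1 - T₁.indicator 1

/-- `f` is an eigenfunction of the graph `Γ` with intersection array `A`, and it meets the
weight-distribution bound: it has exactly `∑_{i=0}^{D} |W^i_{A,θ}|` nonzeros, where `θ` is the
eigenvalue of `f`. -/
def MeetsWDBound [Fintype V] (Γ : SimpleGraph V) {D : ℕ} (A : IntersectionArray D)
    (f : V → ℝ) : Prop :=
  ∃ θ : ℝ, Γ.IsEigenfunction f θ ∧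
    ((Function.support f).ncard : ℝ) = ∑ i ∈ Finset.range (D + 1), |A.wdCoeff θ i|

/-- The subgraph `H` of `Γ` is isometric: it is connected and distances in `H` are the distances
in `Γ`. -/
def IsIsometricSubgraph (Γ : SimpleGraph V) (H : Γ.Subgraph) : Prop :=
  H.coe.Connected ∧ ∀ x y : H.verts, H.coe.dist x y = Γ.dist (x : V) (y : V)

end SimpleGraph

/-! ### Distance-regular graphs: sphere sums and the weight distribution. -/

namespace SimpleGraph

variable {V : Type*}

/-! For a clique pair and θ with `k + s * θ = 0`, the eigenfunctions for θ are the nonzero functions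
with sum zero on every clique of `S`, and such a θ, once it is an eigenvalue, is the minimum one.
Averaging an eigenfunction over the spheres around a nonzero `x` gives a radial solution `v`,
determined by `A` and θ. It alternates in sign, since a clique joining two consecutive spheres has
sum zero.

The sum of `f` over the sphere of radius i around `x` is W^i f(x). For values 0, ±1 the triangle
inequality thus gives the w.d. bound, with equality exactly when the nonzeros at distance i from `x`
all have the value (-1)^i f(x) (`IsCliquePair.eq_of_meets`). Hence the other nonzero in a clique
through a nonzero `y` is never as far from `x` as `y`. This makes the support isometric and lets
c'_i be computed clique by clique from `v` (`IsBitrade.card_adj_dist_pred`); the support has degree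
-θ and no edges inside spheres, so b'_i = -θ - c'_i.

Conversely, if b'_i + c'_i = -θ for all i, the subgraph has no edges inside spheres. Splitting it by
parity of the distance from a vertex gives a bitrade, by counting cliques
(`IsCliquePair.isBitrade_parity`); its sphere sums involve no cancellation, so the bound is met.

Since `A` determines the minimum eigenvalue, the array found from one graph with a bitrade serves
all graphs with array `A`. -/

theorem Connected.exists_adj_of_dist_eq_succ {Γ : SimpleGraph V} (h : Γ.Connected) {x y : V} {n : ℕ}
    (hn : Γ.dist x y = n + 1) : ∃ z, Γ.Adj y z ∧ Γ.dist x z = n := by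
  obtain ⟨p, hp⟩ := h.exists_walk_length_eq_dist y x
  cases p with
  | nil => simp at hn
  | @cons _ z _ hyz q =>
    refine ⟨z, hyz, ?_⟩
    rw [Walk.length_cons, dist_comm, hn] at hp
    have h1 := dist_le q
    have h2 := hyz.symm.diff_dist_adj (u := x)
    rw [dist_comm] at h1
    omega

/-- A version of `SimpleGraph.Adj.diff_dist_adj` phrased without subtraction. -/
theorem Adj.dist_cases {Γ : SimpleGraph V} {y z : V} (h : Γ.Adj y z) (x : V) :
    Γ.dist x z = Γ.dist x y + 1 ∨ Γ.dist x z = Γ.dist x y ∨ Γ.dist x z + 1 = Γ.dist x y := by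
  have := h.diff_dist_adj (u := x)
  omega

open scoped Classical in
/-- The sum of `f` over the sphere of radius `i` around `x`. -/
noncomputable def sphereSum [Fintype V] (Γ : SimpleGraph V) (f : V → ℝ) (x : V) (i : ℕ) : ℝ :=
  ∑ y with Γ.dist x y = i, f y

namespace HasIntersectionArray

variable {Γ : SimpleGraph V} {D : ℕ} {A : IntersectionArray D}

theorem dist_le (h : Γ.HasIntersectionArray A) (x y : V) : Γ.dist x y ≤ D := by
  by_contra! hlt
  obtain ⟨n, hn⟩ := Nat.exists_eq_add_of_lt hlt
  induction n generalizing y with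
  | zero => exact (h.sphere_succ_eq_empty x).subset (show y ∈ Γ.distSphere (D + 1) x from hn)
  | succ n ih =>
    obtain ⟨z, -, hz⟩ := h.connected.exists_adj_of_dist_eq_succ (x := x) (y := y) (n := D + n + 1)
      (by omega)
    exact ih z (by omega) hz

theorem bAt_top (A : IntersectionArray D) : A.bAt D = 0 := by
  simp [IntersectionArray.bAt]

theorem cAt_zero (A : IntersectionArray D) : A.cAt 0 = 0 := by
  simp [IntersectionArray.cAt]

theorem exists_dist_eq (h : Γ.HasIntersectionArray A) (x : V) {i : ℕ} (hi : i ≤ D) :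
    ∃ y, Γ.dist x y = i := by
  induction hi using Nat.decreasingInduction with
  | of_succ k _ ih =>
    obtain ⟨y, hy⟩ := ih
    obtain ⟨z, -, hz⟩ := h.connected.exists_adj_of_dist_eq_succ hy
    exact ⟨z, hz⟩
  | self => exact h.sphere_nonempty x

section Fintype

open scoped Classical

variable [Fintype V]

theorem card_adj_dist_succ (h : Γ.HasIntersectionArray A) (x y : V) :
    ({z | Γ.Adj y z ∧ Γ.dist x z = Γ.dist x y + 1} : Finset V).card = A.bAt (Γ.dist x y) := by
  have h1 := h.card_b x _ (h.dist_le x y) y rfl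
  rw [← ENat.natCast_inj, ← h1, ← Set.encard_coe_eq_coe_finsetCard]
  congr 1
  ext z
  simp [distSphere, and_comm]

theorem card_adj_dist_pred (h : Γ.HasIntersectionArray A) (x y : V) :
    ({z | Γ.Adj y z ∧ Γ.dist x z + 1 = Γ.dist x y} : Finset V).card = A.cAt (Γ.dist x y) := by
  have h1 := h.card_c x _ (h.dist_le x y) y rfl
  rw [← ENat.natCast_inj, ← h1, ← Set.encard_coe_eq_coe_finsetCard]
  congr 1
  ext z
  simp [and_comm]

theorem card_adj (h : Γ.HasIntersectionArray A) (y : V) :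
    ({z | Γ.Adj y z} : Finset V).card = A.bAt 0 := by
  have h1 := h.card_adj_dist_succ y y
  rw [dist_self] at h1
  rw [← h1]
  congr 1
  ext z
  simp [dist_eq_one_iff_adj]

/-- The sum over the neighbours of `y` of a function of the distance from `x`. -/
theorem sum_adj_dist (h : Γ.HasIntersectionArray A) (g : ℕ → ℝ) (x y : V) :
    ∑ z with Γ.Adj y z, g (Γ.dist x z) =
      A.bAt (Γ.dist x y) * g (Γ.dist x y + 1) + A.aAt (Γ.dist x y) * g (Γ.dist x y) +
        A.cAt (Γ.dist x y) * g (Γ.dist x y - 1) := by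
  set i := Γ.dist x y with hi
  have key : ∀ z ∈ ({z | Γ.Adj y z} : Finset V), g (Γ.dist x z) =
      (if Γ.dist x z = i + 1 then g (i + 1) - g i else 0) +
      (if Γ.dist x z + 1 = i then g (i - 1) - g i else 0) + g i := by
    intro z hz
    have := Adj.dist_cases (by simpa using hz) x (y := y) (z := z)
    rcases this with h1 | h1 | h1
    · rw [if_pos h1, if_neg (by omega), h1]; ring
    · simp [h1, ← hi]
    · rw [if_neg (by omega), if_pos (by omega), show Γ.dist x z = i - 1 by omega]; ring
  rw [Finset.sum_congr rfl key, Finset.sum_add_distrib, Finset.sum_add_distrib,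
    ← Finset.sum_filter, ← Finset.sum_filter, Finset.filter_filter, Finset.filter_filter,
    Finset.sum_const, Finset.sum_const, Finset.sum_const, h.card_adj_dist_succ x y,
    h.card_adj_dist_pred x y, h.card_adj, ← hi]
  simp only [nsmul_eq_mul, IntersectionArray.aAt]
  ring

theorem filter_dist_eq_zero (h : Γ.HasIntersectionArray A) (x : V) :
    ({y | Γ.dist x y = 0} : Finset V) = {x} := by
  ext y
  simp [h.connected.dist_eq_zero_iff, eq_comm]

theorem sphereSum_zero (h : Γ.HasIntersectionArray A) (f : V → ℝ) (x : V) :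
    Γ.sphereSum f x 0 = f x := by
  rw [sphereSum, h.filter_dist_eq_zero, Finset.sum_singleton]

theorem sphereSum_succ_top (h : Γ.HasIntersectionArray A) (f : V → ℝ) (x : V) :
    Γ.sphereSum f x (D + 1) = 0 := by
  refine Finset.sum_eq_zero fun y hy => ?_
  have := h.dist_le x y
  simp at hy
  omega

theorem sum_sphereSum (h : Γ.HasIntersectionArray A) (f : V → ℝ) (x : V) :
    ∑ i ∈ Finset.range (D + 1), Γ.sphereSum f x i = ∑ y, f y :=
  Finset.sum_fiberwise_of_maps_to (fun y _ => by simpa [Nat.lt_succ_iff] using h.dist_le x y) _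

/-- Exchanging the sums weights each `z` by its number of neighbours on the sphere. The truncated
`Γ.dist x z - 1` at distance 0 is harmless because c_0 = 0. -/
theorem sum_sphere_sum_adj (h : Γ.HasIntersectionArray A) (f : V → ℝ) (x : V) (i : ℕ) :
    ∑ y with Γ.dist x y = i, ∑ z with Γ.Adj y z, f z =
      ∑ z, f z * (A.bAt (Γ.dist x z) * (if Γ.dist x z + 1 = i then 1 else 0)
        + A.aAt (Γ.dist x z) * (if Γ.dist x z = i then 1 else 0)
        + A.cAt (Γ.dist x z) * (if Γ.dist x z - 1 = i then 1 else 0)) := by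
  have : ∀ z, f z * (A.bAt (Γ.dist x z) * (if Γ.dist x z + 1 = i then 1 else 0)
        + A.aAt (Γ.dist x z) * (if Γ.dist x z = i then 1 else 0)
        + A.cAt (Γ.dist x z) * (if Γ.dist x z - 1 = i then 1 else 0)) =
      ∑ y, if Γ.dist x y = i ∧ Γ.Adj y z then f z else 0 := by
    intro z
    rw [← h.sum_adj_dist (fun j => if j = i then 1 else 0) x z, Finset.mul_sum, Finset.sum_filter]
    refine Finset.sum_congr rfl fun y _ => ?_
    by_cases h1 : Γ.dist x y = i <;> simp [h1, Γ.adj_comm]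
  simp_rw [this]
  rw [Finset.sum_comm, Finset.sum_filter]
  refine Finset.sum_congr rfl fun y _ => ?_
  by_cases h1 : Γ.dist x y = i <;> simp [h1, Finset.sum_filter]

theorem sum_sphere_zero_sum_adj (h : Γ.HasIntersectionArray A) (f : V → ℝ) (x : V) :
    ∑ y with Γ.dist x y = 0, ∑ z with Γ.Adj y z, f z = Γ.sphereSum f x 1 := by
  rw [h.filter_dist_eq_zero, Finset.sum_singleton]
  simp [sphereSum, dist_eq_one_iff_adj]

theorem sum_sphere_succ_sum_adj (h : Γ.HasIntersectionArray A) (f : V → ℝ) (x : V) (i : ℕ) :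
    ∑ y with Γ.dist x y = i + 1, ∑ z with Γ.Adj y z, f z =
      A.bAt i * Γ.sphereSum f x i + A.aAt (i + 1) * Γ.sphereSum f x (i + 1)
        + A.cAt (i + 2) * Γ.sphereSum f x (i + 2) := by
  rw [h.sum_sphere_sum_adj, sphereSum, sphereSum, sphereSum]
  simp only [Finset.sum_filter, Finset.mul_sum, ← Finset.sum_add_distrib]
  refine Finset.sum_congr rfl fun z _ => ?_
  generalize Γ.dist x z = j
  rcases lt_trichotomy j (i + 1) with h1 | rfl | h1
  · rcases eq_or_ne j i with rfl | h2
    · simp [show j - 1 ≠ j + 1 by omega, mul_comm]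
    · simp [h2, h1.ne, show j ≠ i + 2 by omega, show j - 1 ≠ i + 1 by omega]
  · simp [mul_comm]
  · rcases eq_or_ne j (i + 2) with rfl | h2
    · simp [mul_comm]
    · simp [h2, h1.ne', show j ≠ i by omega, show j - 1 ≠ i + 1 by omega]

/-- The number of vertices at distance `i` from `x`. -/
theorem sphereSum_one_pos (h : Γ.HasIntersectionArray A) (x : V) {i : ℕ} (hi : i ≤ D) :
    0 < Γ.sphereSum 1 x i := by
  obtain ⟨y, hy⟩ := h.exists_dist_eq x hi
  exact Finset.sum_pos (fun _ _ => by simp) ⟨y, by simpa using hy⟩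

/-- Both sides count the edges between two consecutive spheres. -/
theorem bAt_mul_sphereSum_one (h : Γ.HasIntersectionArray A) (x : V) (i : ℕ) :
    A.bAt i * Γ.sphereSum 1 x i = A.cAt (i + 1) * Γ.sphereSum 1 x (i + 1) := by
  have key : ∀ y, ∑ z with Γ.Adj y z, (if Γ.dist x z = i + 1 then (1 : ℝ) else 0) =
      A.bAt (Γ.dist x y) * (if Γ.dist x y = i then 1 else 0) +
      A.aAt (Γ.dist x y) * (if Γ.dist x y = i + 1 then 1 else 0) +
      A.cAt (Γ.dist x y) * (if Γ.dist x y - 1 = i + 1 then 1 else 0) := by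
    intro y
    rw [h.sum_adj_dist (fun j => if j = i + 1 then 1 else 0)]
    simp
  have h1 : ∑ y with Γ.dist x y = i, ∑ z with Γ.Adj y z, (if Γ.dist x z = i + 1 then (1 : ℝ) else 0)
      = A.bAt i * Γ.sphereSum 1 x i := by
    rw [sphereSum, Finset.mul_sum]
    refine Finset.sum_congr rfl fun y hy => ?_
    have hy : Γ.dist x y = i := by simpa using hy
    simp [key, hy, show i - 1 ≠ i + 1 by omega]
  rw [← h1, h.sum_sphere_sum_adj, sphereSum, Finset.mul_sum, Finset.sum_filter]
  refine Finset.sum_congr rfl fun z _ => ?_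
  by_cases hz : Γ.dist x z = i + 1
  · simp [hz, show i + 1 + 1 ≠ i by omega]
  · simp [hz]

theorem bAt_pos (h : Γ.HasIntersectionArray A) {i : ℕ} (hi : i < D) : 0 < A.bAt i := by
  obtain ⟨x⟩ := h.connected.nonempty
  obtain ⟨y, hy⟩ := h.exists_dist_eq x (Nat.succ_le_of_lt hi)
  obtain ⟨z, hz, hzd⟩ := h.connected.exists_adj_of_dist_eq_succ hy
  rw [← hzd, ← h.card_adj_dist_succ x z, Finset.card_pos]
  exact ⟨y, by simp [hz.symm, hy, hzd]⟩

theorem cAt_pos (h : Γ.HasIntersectionArray A) {i : ℕ} (hi : i + 1 ≤ D) : 0 < A.cAt (i + 1) := by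
  obtain ⟨x⟩ := h.connected.nonempty
  obtain ⟨y, hy⟩ := h.exists_dist_eq x hi
  obtain ⟨z, hz, hzd⟩ := h.connected.exists_adj_of_dist_eq_succ hy
  rw [← hy, ← h.card_adj_dist_pred x y, Finset.card_pos]
  exact ⟨z, by simp [hz, hy, hzd]⟩

theorem aAt_zero (A : IntersectionArray D) : A.aAt 0 = 0 := by
  simp [IntersectionArray.aAt, cAt_zero]

theorem mul_sphereSum {f : V → ℝ} {θ : ℝ} (hf : Γ.IsEigenfunction f θ) (x : V) (i : ℕ) :
    ∑ y with Γ.dist x y = i, ∑ z with Γ.Adj y z, f z = θ * Γ.sphereSum f x i := by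
  rw [sphereSum, Finset.mul_sum]
  exact Finset.sum_congr rfl fun y _ => hf.2 y

/-- The weight distribution of an eigenfunction. -/
theorem sphereSum_eq_wdCoeff (h : Γ.HasIntersectionArray A) {f : V → ℝ} {θ : ℝ}
    (hf : Γ.IsEigenfunction f θ) (x : V) {i : ℕ} (hi : i ≤ D) :
    Γ.sphereSum f x i = A.wdCoeff θ i * f x := by
  induction i using Nat.strong_induction_on with
  | _ i ih =>
    match i with
    | 0 => simp [h.sphereSum_zero, IntersectionArray.wdCoeff]
    | 1 =>
      rw [← h.sum_sphere_zero_sum_adj, mul_sphereSum hf, h.sphereSum_zero,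
        IntersectionArray.wdCoeff]
    | i + 2 =>
      have h1 := h.sum_sphere_succ_sum_adj f x i
      rw [mul_sphereSum hf, ih i (by omega) (by omega), ih (i + 1) (by omega) (by omega)] at h1
      have hc : (A.cAt (i + 2) : ℝ) ≠ 0 := by exact_mod_cast (h.cAt_pos hi).ne'
      rw [IntersectionArray.wdCoeff]
      field_simp
      linarith

end Fintype

end HasIntersectionArray

/-! ### Radial eigenfunctions. -/

/-- `v` is the sequence of values of an eigenfunction with eigenvalue `θ` that depends only on the
distance from a fixed vertex, where it is `1`. -/
def _root_.IntersectionArray.IsRadial {D : ℕ} (A : IntersectionArray D) (θ : ℝ) (v : ℕ → ℝ) :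
    Prop :=
  v 0 = 1 ∧ ∀ i ≤ D, A.bAt i * v (i + 1) + A.aAt i * v i + A.cAt i * v (i - 1) = θ * v i

namespace HasIntersectionArray

variable [Fintype V] {Γ : SimpleGraph V} {D : ℕ} {A : IntersectionArray D} {θ : ℝ}

theorem isEigenfunction_of_isRadial (h : Γ.HasIntersectionArray A) {v : ℕ → ℝ}
    (hv : A.IsRadial θ v) (x : V) : Γ.IsEigenfunction (fun y => v (Γ.dist x y)) θ := by
  refine ⟨fun h0 => ?_, fun y => ?_⟩
  · have := congrFun h0 x
    simp [hv.1] at this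
  · rw [h.sum_adj_dist v x y, hv.2 _ (h.dist_le x y)]

/-- The normalised averages of `f` over spheres satisfy the radial recurrence: it is the recurrence
for sphere sums, transposed by `bAt_mul_sphereSum_one`. -/
theorem isRadial_sphereSum (h : Γ.HasIntersectionArray A) {f : V → ℝ}
    (hf : Γ.IsEigenfunction f θ) {x : V} (hx : f x ≠ 0) :
    A.IsRadial θ fun i => Γ.sphereSum f x i / (Γ.sphereSum 1 x i * f x) := by
  refine ⟨by simp [h.sphereSum_zero, hx], fun i hi => ?_⟩
  have hK := (h.sphereSum_one_pos x hi).ne'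
  have hup : A.bAt i * (Γ.sphereSum f x (i + 1) / (Γ.sphereSum 1 x (i + 1) * f x)) =
      A.cAt (i + 1) * Γ.sphereSum f x (i + 1) / (Γ.sphereSum 1 x i * f x) := by
    rcases hi.lt_or_eq with hlt | rfl
    · have hK' := (h.sphereSum_one_pos x hlt).ne'
      have := h.bAt_mul_sphereSum_one x i
      field_simp
      linear_combination Γ.sphereSum f x (i + 1) * this
    · simp [h.sphereSum_succ_top]
  dsimp only
  rw [hup]
  rcases i with _ | i
  · have h1 := h.sum_sphere_zero_sum_adj f x
    have h2 := h.bAt_mul_sphereSum_one x 0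
    -- c_1 = 1, except that for D = 0 it is 0 by convention; then the sphere is empty.
    have hc : (A.cAt 1 : ℝ) * Γ.sphereSum f x 1 = Γ.sphereSum f x 1 := by
      rcases hi.lt_or_eq with hlt | rfl
      · obtain ⟨y, hy⟩ := h.exists_dist_eq x hlt
        have h3 : _ = A.cAt _ := h.card_adj_dist_pred x y
        rw [hy] at h3
        have h4 : A.cAt 1 = 1 := by
          change _ = A.cAt 1 at h3
          rw [← h3, Finset.card_eq_one]
          refine ⟨x, ?_⟩
          ext z
          have : Γ.Adj x y := dist_eq_one_iff_adj.1 hy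
          simp only [Finset.mem_filter, Finset.mem_univ, true_and, Finset.mem_singleton,
            Nat.add_eq_right, h.connected.dist_eq_zero_iff]
          exact ⟨fun h => h.2.symm, fun h => by simp [h, this.symm]⟩
        simp [h4]
      · simp [h.sphereSum_succ_top f x]
    rw [mul_sphereSum hf] at h1
    simp only [aAt_zero, cAt_zero, zero_add]
    rw [hc, ← h1]
    simp
    ring
  · have h1 := h.sum_sphere_succ_sum_adj f x i
    rw [mul_sphereSum hf] at h1
    have hK' := (h.sphereSum_one_pos x (show i ≤ D by omega)).ne'
    have h2 := h.bAt_mul_sphereSum_one x i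
    simp only [Nat.add_sub_cancel]
    have hdown : A.cAt (i + 1) * (Γ.sphereSum f x i / (Γ.sphereSum 1 x i * f x)) =
      A.bAt i * Γ.sphereSum f x i / (Γ.sphereSum 1 x (i + 1) * f x) := by
      field_simp
      linear_combination -Γ.sphereSum f x i * h2
    rw [hdown]
    field_simp
    linarith

/-- Since b_i ≠ 0 for i < D, the recurrence determines each value from the two before it. -/
theorem isRadial_unique (h : Γ.HasIntersectionArray A) {v w : ℕ → ℝ} (hv : A.IsRadial θ v)
    (hw : A.IsRadial θ w) {i : ℕ} (hi : i ≤ D) : v i = w i := by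
  induction i using Nat.strong_induction_on with
  | _ i ih =>
    rcases i with _ | i
    · rw [hv.1, hw.1]
    · have h1 := hv.2 i (by omega)
      rw [ih i (by omega) (by omega), ih (i - 1) (by omega) (by omega)] at h1
      have h2 := hw.2 i (by omega)
      have hb : (A.bAt i : ℝ) ≠ 0 := by exact_mod_cast (h.bAt_pos hi).ne'
      exact mul_left_cancel₀ hb (by linarith)

theorem exists_isRadial (h : Γ.HasIntersectionArray A) {f : V → ℝ}
    (hf : Γ.IsEigenfunction f θ) : ∃ v, A.IsRadial θ v := by
  obtain ⟨x, hx⟩ := Function.ne_iff.1 hf.1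
  exact ⟨_, h.isRadial_sphereSum hf hx⟩

theorem exists_isEigenfunction_iff (h : Γ.HasIntersectionArray A) :
    (∃ f, Γ.IsEigenfunction f θ) ↔ ∃ v, A.IsRadial θ v := by
  refine ⟨fun ⟨f, hf⟩ => h.exists_isRadial hf, fun ⟨v, hv⟩ => ?_⟩
  obtain ⟨x⟩ := h.connected.nonempty
  exact ⟨_, h.isEigenfunction_of_isRadial hv x⟩

/-- The right-hand side mentions only `A`, so graphs with the same array share their minimum
eigenvalue. -/
theorem isMinEigenvalue_iff (h : Γ.HasIntersectionArray A) :
    Γ.IsMinEigenvalue θ ↔ IsLeast {μ | ∃ v, A.IsRadial μ v} θ := by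
  simp [IsMinEigenvalue, h.exists_isEigenfunction_iff]

theorem sphereSum_eq_of_isRadial (h : Γ.HasIntersectionArray A) {f : V → ℝ}
    (hf : Γ.IsEigenfunction f θ) {v : ℕ → ℝ} (hv : A.IsRadial θ v) {x : V} (hx : f x ≠ 0)
    {i : ℕ} (hi : i ≤ D) : Γ.sphereSum f x i = Γ.sphereSum 1 x i * v i * f x := by
  rw [h.isRadial_unique hv (h.isRadial_sphereSum hf hx) hi]
  have hK := (h.sphereSum_one_pos x hi).ne'
  field_simp

end HasIntersectionArray

end SimpleGraph

/-! ### Clique pairs and the minimum eigenvalue. -/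

namespace SimpleGraph

variable {V : Type*}

namespace IsCliquePair

variable {Γ : SimpleGraph V} {k s m : ℕ} {S : Set (Finset V)}

theorem exists_mem (h : Γ.IsCliquePair k s m S) {x y : V} (hxy : Γ.Adj x y) :
    ∃ C ∈ S, x ∈ C ∧ y ∈ C := by
  have h1 : {C ∈ S | x ∈ C ∧ y ∈ C}.Nonempty := by
    rw [← Set.encard_ne_zero, h.card_edge x y hxy]
    exact_mod_cast h.m_pos.ne'
  exact h1

theorem adj_of_mem (h : Γ.IsCliquePair k s m S) {C : Finset V} (hC : C ∈ S) {x y : V}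
    (hx : x ∈ C) (hy : y ∈ C) (hxy : x ≠ y) : Γ.Adj x y :=
  (h.isNClique C hC).isClique hx hy hxy

theorem exists_adj [Nontrivial V] (h : Γ.IsCliquePair k s m S) (x : V) : ∃ y, Γ.Adj x y :=
  h.connected.preconnected.exists_adj_of_nontrivial x

theorem s_pos [Nontrivial V] (h : Γ.IsCliquePair k s m S) : 0 < s := by
  obtain ⟨x⟩ := h.connected.nonempty
  obtain ⟨y, hxy⟩ := h.exists_adj x
  obtain ⟨C, hC, hx, hy⟩ := h.exists_mem hxy
  have := Finset.one_lt_card.2 ⟨x, hx, y, hy, hxy.ne⟩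
  have := (h.isNClique C hC).card_eq
  omega

theorem k_pos [Nontrivial V] (h : Γ.IsCliquePair k s m S) : 0 < k := by
  obtain ⟨x⟩ := h.connected.nonempty
  obtain ⟨y, hxy⟩ := h.exists_adj x
  have h1 : (Γ.neighborSet x).encard ≠ 0 := Set.encard_ne_zero.2 ⟨y, hxy⟩
  rw [h.regular x] at h1
  exact Nat.pos_of_ne_zero (by exact_mod_cast h1)

theorem neg_of_eq_zero [Nontrivial V] (h : Γ.IsCliquePair k s m S) {θ : ℝ} (hθ : k + s * θ = 0) : θ < 0 := by
  have hs : (0 : ℝ) < s := by exact_mod_cast h.s_pos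
  have hk : (0 : ℝ) < k := by exact_mod_cast h.k_pos
  by_contra! h0
  have := mul_nonneg hs.le h0
  linarith

theorem dist_mem (h : Γ.IsCliquePair k s m S) {C : Finset V} (hC : C ∈ S) {x y z u : V} {i : ℕ}
    (hy : y ∈ C) (hz : z ∈ C) (hu : u ∈ C) (hxy : Γ.dist x y = i + 1) (hxz : Γ.dist x z = i) :
    Γ.dist x u = i ∨ Γ.dist x u = i + 1 := by
  rcases eq_or_ne y u with rfl | hyu
  · exact .inr hxy
  rcases eq_or_ne z u with rfl | hzu
  · exact .inl hxz
  have h1 := (h.adj_of_mem hC hy hu hyu).dist_cases x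
  have h2 := (h.adj_of_mem hC hz hu hzu).dist_cases x
  omega

section Fintype

open scoped Classical

variable [Fintype V]

/-- The double count of the pairs (neighbour of `y`, clique through both). -/
theorem sum_sum_erase (h : Γ.IsCliquePair k s m S) (g : V → ℝ) (y : V) :
    ∑ C : Finset V with C ∈ S ∧ y ∈ C, ∑ z ∈ C.erase y, g z = m * ∑ z with Γ.Adj y z, g z := by
  have h1 : ∀ z, (∑ C : Finset V with C ∈ S ∧ y ∈ C, if z ∈ C.erase y then g z else 0) =
      if Γ.Adj y z then m * g z else 0 := by
    intro z
    split_ifs with hyz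
    · rw [← Finset.sum_filter, Finset.sum_const, nsmul_eq_mul]
      congr 2
      rw [← ENat.natCast_inj, ← h.card_edge y z hyz, ← Set.encard_coe_eq_coe_finsetCard]
      congr 1
      ext C
      simp [hyz.ne', and_assoc]
    · refine Finset.sum_eq_zero fun C hC => if_neg fun hz => hyz ?_
      simp only [Finset.mem_filter, Finset.mem_univ, true_and, Finset.mem_erase] at hC hz
      exact h.adj_of_mem hC.1 hC.2 hz.2 (Ne.symm hz.1)
  rw [Finset.mul_sum, Finset.sum_filter (fun z => Γ.Adj y z), ← Finset.sum_congr rfl fun z _ => h1 z,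
    Finset.sum_comm]
  refine Finset.sum_congr rfl fun C _ => ?_
  rw [Finset.sum_ite_mem, Finset.univ_inter]

theorem card_neighbors (h : Γ.IsCliquePair k s m S) (y : V) :
    ({z | Γ.Adj y z} : Finset V).card = k := by
  rw [← ENat.natCast_inj, ← h.regular y, ← Set.encard_coe_eq_coe_finsetCard]
  congr 1
  ext z
  simp

theorem bAt_zero_eq {D : ℕ} {A : IntersectionArray D} (h : Γ.IsCliquePair k s m S)
    (hA : Γ.HasIntersectionArray A) : A.bAt 0 = k := by
  obtain ⟨x⟩ := h.connected.nonempty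
  rw [← hA.card_adj x, h.card_neighbors]

theorem card_cliques (h : Γ.IsCliquePair k s m S) (y : V) :
    (s : ℝ) * ({C | C ∈ S ∧ y ∈ C} : Finset (Finset V)).card = m * k := by
  have h1 := h.sum_sum_erase 1 y
  simp only [Pi.one_apply, Finset.sum_const, nsmul_eq_mul, mul_one, h.card_neighbors] at h1
  rw [← h1, mul_comm, ← nsmul_eq_mul, ← Finset.sum_const]
  refine Finset.sum_congr rfl fun C hC => ?_
  simp only [Finset.mem_filter, Finset.mem_univ, true_and] at hC
  rw [Finset.card_erase_of_mem hC.2, (h.isNClique C hC.1).card_eq, Nat.add_sub_cancel]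

/-- On expanding the squares, each vertex is counted mk/s times and each ordered adjacent pair m
times. -/
theorem sum_sq_clique (h : Γ.IsCliquePair k s m S) {f : V → ℝ} {θ : ℝ}
    (hf : Γ.IsEigenfunction f θ) :
    s * ∑ C with C ∈ S, (∑ x ∈ C, f x) ^ 2 = m * (k + s * θ) * ∑ x, f x ^ 2 := by
  have h1 : ∑ C with C ∈ S, (∑ x ∈ C, f x) ^ 2 =
      ∑ x, ∑ C : Finset V with C ∈ S ∧ x ∈ C, f x * ∑ z ∈ C, f z := by
    have : ∀ C : Finset V, (∑ x ∈ C, f x) ^ 2 = ∑ x, if x ∈ C then f x * ∑ z ∈ C, f z else 0 := by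
      intro C
      rw [sq, Finset.sum_mul]
      simp
    simp_rw [this]
    rw [Finset.sum_comm]
    refine Finset.sum_congr rfl fun x _ => ?_
    rw [← Finset.sum_filter, Finset.filter_filter]
  have h2 : ∀ x, ∑ C : Finset V with C ∈ S ∧ x ∈ C, f x * ∑ z ∈ C, f z =
      f x * (({C | C ∈ S ∧ x ∈ C} : Finset (Finset V)).card * f x + m * (θ * f x)) := by
    intro x
    rw [← hf.2 x, ← h.sum_sum_erase f x, ← Finset.mul_sum, ← nsmul_eq_mul, ← Finset.sum_const,
      ← Finset.sum_add_distrib]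
    congr 1
    refine Finset.sum_congr rfl fun C hC => ?_
    simp only [Finset.mem_filter, Finset.mem_univ, true_and] at hC
    rw [Finset.add_sum_erase _ _ hC.2]
  rw [h1, Finset.mul_sum, Finset.mul_sum]
  refine Finset.sum_congr rfl fun x _ => ?_
  rw [h2]
  linear_combination f x ^ 2 * h.card_cliques x

end Fintype

section Eigenvalue

variable [Fintype V] {θ : ℝ} {f : V → ℝ}

theorem nonneg_of_isEigenfunction (h : Γ.IsCliquePair k s m S) (hf : Γ.IsEigenfunction f θ) :
    0 ≤ k + s * θ := by
  obtain ⟨x, hx⟩ := Function.ne_iff.1 hf.1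
  have hpos : 0 < ∑ x, f x ^ 2 :=
    Finset.sum_pos' (fun _ _ => sq_nonneg _) ⟨x, Finset.mem_univ x, by
      have : f x ≠ 0 := hx
      positivity⟩
  have h1 : 0 ≤ m * (k + s * θ) * ∑ x, f x ^ 2 := by
    rw [← h.sum_sq_clique hf]
    exact mul_nonneg (by positivity) (Finset.sum_nonneg fun _ _ => sq_nonneg _)
  have hm : (0 : ℝ) < m := by exact_mod_cast h.m_pos
  exact nonneg_of_mul_nonneg_right (nonneg_of_mul_nonneg_left h1 hpos) hm

variable [Nontrivial V]

theorem sum_clique_eq_zero (h : Γ.IsCliquePair k s m S) (hf : Γ.IsEigenfunction f θ)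
    (hθ : k + s * θ = 0) {C : Finset V} (hC : C ∈ S) : ∑ x ∈ C, f x = 0 := by
  classical
  have h1 := h.sum_sq_clique hf
  have hs : (s : ℝ) ≠ 0 := by exact_mod_cast h.s_pos.ne'
  rw [hθ, mul_zero, zero_mul, mul_eq_zero, or_iff_right hs,
    Finset.sum_eq_zero_iff_of_nonneg fun _ _ => sq_nonneg _] at h1
  exact pow_eq_zero_iff two_ne_zero |>.1 (h1 C (by simpa using hC))

theorem isMinEigenvalue (h : Γ.IsCliquePair k s m S) (hf : Γ.IsEigenfunction f θ)
    (hθ : k + s * θ = 0) : Γ.IsMinEigenvalue θ := by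
  refine ⟨⟨f, hf⟩, fun μ ⟨g, hg⟩ => ?_⟩
  have h1 := h.nonneg_of_isEigenfunction hg
  rw [← hθ] at h1
  exact le_of_mul_le_mul_left (by linarith) (show (0 : ℝ) < s by exact_mod_cast h.s_pos)

/-- Around `y`, each of the mk/s cliques contributes -f(y), while each neighbour is counted m times.
-/
theorem isEigenfunction (h : Γ.IsCliquePair k s m S) (hf : f ≠ 0)
    (hS : ∀ C ∈ S, ∑ x ∈ C, f x = 0) (hθ : k + s * θ = 0) : Γ.IsEigenfunction f θ := by
  classical
  refine ⟨hf, fun y => ?_⟩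
  have h1 := h.sum_sum_erase f y
  rw [Finset.sum_congr rfl (g := fun _ => - f y) fun C hC => ?_, Finset.sum_const,
    nsmul_eq_mul] at h1
  · have h2 := h.card_cliques y
    have hs : (0 : ℝ) < s := by exact_mod_cast h.s_pos
    have hm : (0 : ℝ) < m := by exact_mod_cast h.m_pos
    refine mul_left_cancel₀ (mul_pos hs hm).ne' ?_
    rw [mul_assoc, ← h1]
    linear_combination -f y * h2 - m * f y * hθ
  · simp only [Finset.mem_filter, Finset.mem_univ, true_and] at hC
    have := Finset.add_sum_erase C f hC.2
    rw [hS C hC.1] at this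
    linarith

/-- The radial eigenfunctions for the minimum eigenvalue alternate in sign. -/
theorem alternating {D : ℕ} {A : IntersectionArray D} (h : Γ.IsCliquePair k s m S)
    (hA : Γ.HasIntersectionArray A) (hθ : k + s * θ = 0) {v : ℕ → ℝ} (hv : A.IsRadial θ v)
    {i : ℕ} (hi : i ≤ D) : 0 < (-1) ^ i * v i := by
  induction i with
  | zero => simp [hv.1]
  | succ i ih =>
    specialize ih (by omega)
    obtain ⟨x⟩ := h.connected.nonempty
    obtain ⟨y, hy⟩ := hA.exists_dist_eq x hi
    obtain ⟨z, hyz, hz⟩ := h.connected.exists_adj_of_dist_eq_succ hy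
    -- This clique takes only the values `v i` and `v (i + 1)`, the first one at `z`; if they did
    -- not have opposite signs, its sum could not vanish.
    obtain ⟨C, hC, hyC, hzC⟩ := h.exists_mem hyz
    have h0 := h.sum_clique_eq_zero (hA.isEigenfunction_of_isRadial hv x) hθ hC
    by_contra! hneg
    rw [pow_succ] at hneg
    have : 0 < ∑ u ∈ C, (-1) ^ i * v (Γ.dist x u) := by
      refine Finset.sum_pos' (fun u hu => ?_) ⟨z, hzC, by rwa [hz]⟩
      rcases h.dist_mem hC hyC hzC hu hy hz with h1 | h1 <;> rw [h1]
      · exact ih.le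
      · linarith
    rw [← Finset.mul_sum, h0, mul_zero] at this
    exact this.false

end Eigenvalue

end IsCliquePair

section Fintype

variable [Fintype V] [Nontrivial V] {Γ : SimpleGraph V} {k s m : ℕ} {S : Set (Finset V)}

theorem IsDelsartePair.exists_isMinEigenvalue (h : Γ.IsDelsartePair k s m S) :
    ∃ θ : ℝ, Γ.IsMinEigenvalue θ ∧ k + s * θ = 0 := by
  have hp := h.isCliquePair
  obtain ⟨x⟩ := hp.connected.nonempty
  obtain ⟨y, hxy⟩ := hp.exists_adj x
  obtain ⟨C, hC, -⟩ := hp.exists_mem hxy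
  obtain ⟨-, θ, hθ, hcard⟩ := h.isDelsarteClique C hC
  refine ⟨θ, hθ, ?_⟩
  rw [(hp.isNClique C hC).card_eq] at hcard
  have hs : (0 : ℝ) < s := by exact_mod_cast hp.s_pos
  -- Division by zero gives 0, so θ = 0 would make the clique a single vertex.
  have h0 : θ ≠ 0 := by
    rintro rfl
    exact hp.s_pos.ne' (by simpa using hcard)
  push_cast at hcard
  field_simp at hcard
  linarith

end Fintype

end SimpleGraph

/-! ### Bitrades. -/

namespace SimpleGraph

variable {V : Type*}

section Bitrade

variable {S : Set (Finset V)} {T₀ T₁ : Set V}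

theorem bitradeFun_of_mem_left (h : Disjoint T₀ T₁) {x : V} (hx : x ∈ T₀) :
    bitradeFun T₀ T₁ x = 1 := by
  simp [bitradeFun, hx, h.notMem_of_mem_left hx]

theorem bitradeFun_of_mem_right (h : Disjoint T₀ T₁) {x : V} (hx : x ∈ T₁) :
    bitradeFun T₀ T₁ x = -1 := by
  simp [bitradeFun, hx, h.notMem_of_mem_right hx]

theorem bitradeFun_of_notMem {x : V} (h₀ : x ∉ T₀) (h₁ : x ∉ T₁) : bitradeFun T₀ T₁ x = 0 := by
  simp [bitradeFun, h₀, h₁]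

theorem abs_bitradeFun (h : Disjoint T₀ T₁) {x : V} (hx : bitradeFun T₀ T₁ x ≠ 0) :
    |bitradeFun T₀ T₁ x| = 1 := by
  by_cases h₀ : x ∈ T₀
  · simp [bitradeFun_of_mem_left h h₀]
  by_cases h₁ : x ∈ T₁
  · simp [bitradeFun_of_mem_right h h₁]
  exact absurd (bitradeFun_of_notMem h₀ h₁) hx

/-- This form treats the two colours alike: a nonzero in a clique has one partner there, of opposite
sign. -/
theorem IsBitrade.exists_mem (h : IsBitrade S T₀ T₁) {C : Finset V} (hC : C ∈ S) {y : V}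
    (hy : y ∈ C) (hfy : bitradeFun T₀ T₁ y ≠ 0) :
    ∃ z ∈ C, z ≠ y ∧ bitradeFun T₀ T₁ z = - bitradeFun T₀ T₁ y ∧
      ∀ u ∈ C, u ≠ y → u ≠ z → bitradeFun T₀ T₁ u = 0 := by
  have hd := h.disjoint
  rcases h.inter C hC with ⟨⟨p, ⟨hpC, hp⟩, hp'⟩, q, ⟨hqC, hq⟩, hq'⟩ | ⟨h₀, h₁⟩
  · have hpq : p ≠ q := fun e => hd.notMem_of_mem_left hp (e ▸ hq)
    have h0 : ∀ u ∈ C, u ≠ p → u ≠ q → bitradeFun T₀ T₁ u = 0 := fun u hu h1 h2 =>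
      bitradeFun_of_notMem (fun h => h1 (hp' u ⟨hu, h⟩)) (fun h => h2 (hq' u ⟨hu, h⟩))
    by_cases hyp : y = p
    · subst hyp
      exact ⟨q, hqC, hpq.symm,
        by rw [bitradeFun_of_mem_left hd hp, bitradeFun_of_mem_right hd hq], h0⟩
    · have hyq : y = q := by
        by_contra hyq
        exact hfy (h0 y hy hyp hyq)
      subst hyq
      exact ⟨p, hpC, hpq,
        by rw [bitradeFun_of_mem_left hd hp, bitradeFun_of_mem_right hd hq, neg_neg],
        fun u hu h1 h2 => h0 u hu h2 h1⟩
  · exact absurd (bitradeFun_of_notMem (Set.disjoint_left.1 h₀ hy) (Set.disjoint_left.1 h₁ hy)) hfy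

theorem IsBitrade.sum_eq_zero (h : IsBitrade S T₀ T₁) {C : Finset V} (hC : C ∈ S) :
    ∑ x ∈ C, bitradeFun T₀ T₁ x = 0 := by
  by_cases h0 : ∀ x ∈ C, bitradeFun T₀ T₁ x = 0
  · exact Finset.sum_eq_zero h0
  · push Not at h0
    obtain ⟨y, hy, hfy⟩ := h0
    obtain ⟨z, hz, hzy, hfz, h'⟩ := h.exists_mem hC hy hfy
    rw [Finset.sum_eq_add_of_mem y z hy hz hzy.symm fun u hu hne => h' u hu hne.1 hne.2, hfz,
      add_neg_cancel]

theorem IsBitrade.bitradeFun_ne_zero (h : IsBitrade S T₀ T₁) : bitradeFun T₀ T₁ ≠ 0 := by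
  obtain ⟨x, hx⟩ := h.nonempty_left
  intro h0
  have := congrFun h0 x
  simp [bitradeFun_of_mem_left h.disjoint hx] at this

end Bitrade

theorem IsEigenfunction.unique [Fintype V] {Γ : SimpleGraph V} {f : V → ℝ} {θ μ : ℝ}
    (h : Γ.IsEigenfunction f θ) (h' : Γ.IsEigenfunction f μ) : θ = μ := by
  obtain ⟨x, hx⟩ := Function.ne_iff.1 h.1
  exact mul_right_cancel₀ hx ((h.2 x).symm.trans (h'.2 x))

open scoped Classical in
theorem sum_abs_eq_ncard_support [Fintype V] {f : V → ℝ} (hf : ∀ x, f x ≠ 0 → |f x| = 1) :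
    ∑ x, |f x| = (Function.support f).ncard := by
  rw [Set.ncard_eq_toFinset_card', ← nsmul_one, ← Finset.sum_const]
  rw [← Finset.sum_filter_ne_zero]
  refine Finset.sum_congr (by ext; simp) fun x hx => hf x (by simpa using hx)

/-! ### Equality in the weight-distribution bound. -/

section Sphere

variable [Fintype V] [Nontrivial V] {Γ : SimpleGraph V} {D : ℕ} {A : IntersectionArray D} {θ : ℝ}
  {k s m : ℕ} {S : Set (Finset V)}

/-- An eigenfunction with values `0`, `±1` that meets the weight distribution bound has constant sign
on the spheres around its nonzeros. -/
theorem IsCliquePair.eq_of_meets (hp : Γ.IsCliquePair k s m S) (hA : Γ.HasIntersectionArray A)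
    (hθ : k + s * θ = 0) {f : V → ℝ} (hf : Γ.IsEigenfunction f θ)
    (hf1 : ∀ x, f x ≠ 0 → |f x| = 1)
    (hw : ((Function.support f).ncard : ℝ) = ∑ i ∈ Finset.range (D + 1), |A.wdCoeff θ i|)
    {x y : V} (hx : f x ≠ 0) (hy : f y ≠ 0) : f y = (-1) ^ Γ.dist x y * f x := by
  classical
  obtain ⟨v, hv⟩ := hA.exists_isRadial hf
  have hle : ∀ i ∈ Finset.range (D + 1),
      |Γ.sphereSum f x i| ≤ Γ.sphereSum (fun y => |f y|) x i := fun i _ =>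
    Finset.abs_sum_le_sum_abs _ _
  -- Meeting the bound turns the summed triangle inequalities into an equality, hence each one
  -- separately.
  have heq : ∑ i ∈ Finset.range (D + 1), |Γ.sphereSum f x i| =
      ∑ i ∈ Finset.range (D + 1), Γ.sphereSum (fun y => |f y|) x i := by
    rw [hA.sum_sphereSum, sum_abs_eq_ncard_support hf1, hw]
    refine Finset.sum_congr rfl fun i hi => ?_
    rw [hA.sphereSum_eq_wdCoeff hf x (Nat.lt_succ_iff.1 (Finset.mem_range.1 hi)), abs_mul, hf1 x hx,
      mul_one]
  have hiD := hA.dist_le x y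
  have h1 := (Finset.sum_eq_sum_iff_of_le hle).1 heq (Γ.dist x y)
    (Finset.mem_range.2 (Nat.lt_succ_of_le hiD))
  set i := Γ.dist x y with hi
  set ε : ℝ := (-1) ^ i * f x with hε
  have hε1 : |ε| = 1 := by simp [hε, abs_mul, hf1 x hx]
  have hεsq : ε * ε = 1 := by rw [← abs_mul_abs_self, hε1, one_mul]
  -- The alternation of `v` identifies ε as the sign of the sphere sum.
  have h2 : |Γ.sphereSum f x i| = ε * Γ.sphereSum f x i := by
    rw [← one_mul |_|, ← hε1, ← abs_mul, abs_of_nonneg]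
    rw [hA.sphereSum_eq_of_isRadial hf hv hx hiD, hε]
    have h3 := hp.alternating hA hθ hv hiD
    have h4 := hA.sphereSum_one_pos x hiD
    have : (-1) ^ i * f x * (Γ.sphereSum 1 x i * v i * f x) =
      Γ.sphereSum 1 x i * ((-1) ^ i * v i) * (f x * f x) := by ring
    rw [this]
    exact mul_nonneg (mul_pos h4 h3).le (mul_self_nonneg _)
  rw [h2, sphereSum, sphereSum, Finset.mul_sum] at h1
  have h3 := (Finset.sum_eq_sum_iff_of_le fun u _ => by
    calc ε * f u ≤ |ε * f u| := le_abs_self _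
      _ = |f u| := by rw [abs_mul, hε1, one_mul]).1 h1 y (by simp [hi])
  rw [hf1 y hy] at h3
  calc f y = ε * ε * f y := by rw [hεsq, one_mul]
    _ = ε := by rw [mul_assoc, h3, mul_one]

/-- Every sphere sum is a nonzero multiple of `f x`. This gives the support the full diameter D. -/
theorem HasIntersectionArray.exists_ne_zero_dist_eq (hA : Γ.HasIntersectionArray A)
    (hp : Γ.IsCliquePair k s m S) (hθ : k + s * θ = 0) {f : V → ℝ} (hf : Γ.IsEigenfunction f θ)
    {x : V} (hx : f x ≠ 0) {i : ℕ} (hi : i ≤ D) : ∃ y, f y ≠ 0 ∧ Γ.dist x y = i := by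
  classical
  obtain ⟨v, hv⟩ := hA.exists_isRadial hf
  have h1 : Γ.sphereSum f x i ≠ 0 := by
    rw [hA.sphereSum_eq_of_isRadial hf hv hx hi]
    refine mul_ne_zero (mul_ne_zero (hA.sphereSum_one_pos x hi).ne' fun h0 => ?_) hx
    have := hp.alternating hA hθ hv hi
    simp [h0] at this
  obtain ⟨y, hy, hfy⟩ := Finset.exists_ne_zero_of_sum_ne_zero h1
  exact ⟨y, hfy, by simpa using hy⟩

end Sphere

/-! ### Counting neighbours inside the support. -/

section Counts

variable {Γ : SimpleGraph V} {D : ℕ} {A : IntersectionArray D} {θ : ℝ}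
  {k s m : ℕ} {S : Set (Finset V)} {T₀ T₁ : Set V} {x y z : V}

theorem IsBitrade.eq_neg_of_adj (hT : IsBitrade S T₀ T₁) (hp : Γ.IsCliquePair k s m S)
    (hyz : Γ.Adj y z) (hy : bitradeFun T₀ T₁ y ≠ 0) (hz : bitradeFun T₀ T₁ z ≠ 0) :
    bitradeFun T₀ T₁ z = - bitradeFun T₀ T₁ y := by
  obtain ⟨C, hC, hyC, hzC⟩ := hp.exists_mem hyz
  obtain ⟨u, -, -, hu, h0⟩ := hT.exists_mem hC hyC hy
  by_cases hzu : z = u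
  · rw [hzu, hu]
  · exact absurd (h0 z hzC hyz.ne' hzu) hz

/-- The sign condition on spheres that holds for a bitrade meeting the weight distribution bound. -/
def AlternatesOnSpheres (Γ : SimpleGraph V) (f : V → ℝ) : Prop :=
  ∀ x y, f x ≠ 0 → f y ≠ 0 → f y = (-1) ^ Γ.dist x y * f x

theorem AlternatesOnSpheres.dist_ne {f : V → ℝ} (h : Γ.AlternatesOnSpheres f) (hx : f x ≠ 0)
    (hy : f y ≠ 0) (hyz : f z = - f y) : Γ.dist x z ≠ Γ.dist x y := by
  intro heq
  have hz : f z ≠ 0 := by rw [hyz]; exact neg_ne_zero.2 hy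
  have h1 := h x z hx hz
  rw [heq, ← h x y hx hy] at h1
  exact hy (by linarith)

/-- A clique through `y` reaching the sphere of radius `n` lies in the spheres `n` and `n + 1`; the
partner of `y` avoids the latter. -/
theorem IsBitrade.exists_adj_dist_pred (hT : IsBitrade S T₀ T₁) (hp : Γ.IsCliquePair k s m S)
    (ha : Γ.AlternatesOnSpheres (bitradeFun T₀ T₁)) {n : ℕ} (hn : Γ.dist x y = n + 1)
    (hx : bitradeFun T₀ T₁ x ≠ 0) (hy : bitradeFun T₀ T₁ y ≠ 0) :
    ∃ z, Γ.Adj y z ∧ bitradeFun T₀ T₁ z ≠ 0 ∧ Γ.dist x z = n := by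
  obtain ⟨u, hyu, hu⟩ := hp.connected.exists_adj_of_dist_eq_succ hn
  obtain ⟨C, hC, hyC, huC⟩ := hp.exists_mem hyu
  obtain ⟨w, hwC, hwy, hfw, -⟩ := hT.exists_mem hC hyC hy
  refine ⟨w, hp.adj_of_mem hC hyC hwC hwy.symm, by rw [hfw]; exact neg_ne_zero.2 hy, ?_⟩
  have h1 := ha.dist_ne hx hy hfw
  have h2 := hp.dist_mem hC hyC huC hwC hn hu
  omega

open scoped Classical

variable [Fintype V]

theorem IsBitrade.card_adj (hT : IsBitrade S T₀ T₁) (hp : Γ.IsCliquePair k s m S)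
    (hf : Γ.IsEigenfunction (bitradeFun T₀ T₁) θ) (hy : bitradeFun T₀ T₁ y ≠ 0) :
    (({z | Γ.Adj y z ∧ bitradeFun T₀ T₁ z ≠ 0} : Finset V).card : ℝ) = -θ := by
  have h1 := hf.2 y
  rw [← Finset.sum_filter_ne_zero, Finset.filter_filter,
    Finset.sum_congr rfl (g := fun _ => - bitradeFun T₀ T₁ y), Finset.sum_const,
    nsmul_eq_mul] at h1
  · exact mul_right_cancel₀ hy (by linarith)
  · intro z hz
    simp only [Finset.mem_filter, Finset.mem_univ, true_and] at hz
    exact hT.eq_neg_of_adj hp hz.1 hy hz.2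

variable [Nontrivial V] in
-- All cliques through `y` that reach the inner sphere have equally many vertices there, because `v`
-- sums to zero on them, and exactly one of these is a nonzero. So c_i and its analogue in the
-- support have a ratio fixed by `v` and `s`.
theorem IsBitrade.card_adj_dist_pred (hT : IsBitrade S T₀ T₁) (hp : Γ.IsCliquePair k s m S)
    (hA : Γ.HasIntersectionArray A) (hθ : k + s * θ = 0)
    (ha : Γ.AlternatesOnSpheres (bitradeFun T₀ T₁)) {v : ℕ → ℝ} (hv : A.IsRadial θ v)
    (hx : bitradeFun T₀ T₁ x ≠ 0) (hy : bitradeFun T₀ T₁ y ≠ 0) :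
    A.cAt (Γ.dist x y) * (v (Γ.dist x y) - v (Γ.dist x y - 1)) = (s + 1) * v (Γ.dist x y) *
      ({z | Γ.Adj y z ∧ bitradeFun T₀ T₁ z ≠ 0 ∧ Γ.dist x z + 1 = Γ.dist x y} : Finset V).card := by
  set i := Γ.dist x y with hi
  have hm : (m : ℝ) ≠ 0 := by exact_mod_cast hp.m_pos.ne'
  have h1 := hp.sum_sum_erase (fun z => if Γ.dist x z + 1 = i then 1 else 0) y
  have h2 := hp.sum_sum_erase
    (fun z => if bitradeFun T₀ T₁ z ≠ 0 ∧ Γ.dist x z + 1 = i then 1 else 0) y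
  have e1 : ∑ z with Γ.Adj y z, (if Γ.dist x z + 1 = i then (1 : ℝ) else 0) = A.cAt i := by
    rw [← Finset.sum_filter, Finset.filter_filter, Finset.sum_const, nsmul_one,
      hA.card_adj_dist_pred]
  rw [e1] at h1
  rw [← Finset.sum_filter, Finset.filter_filter, Finset.sum_const, nsmul_one] at h2
  have key : ∀ C ∈ ({C | C ∈ S ∧ y ∈ C} : Finset (Finset V)),
      (∑ z ∈ C.erase y, if Γ.dist x z + 1 = i then (1 : ℝ) else 0) * (v i - v (i - 1)) =
      (∑ z ∈ C.erase y, if bitradeFun T₀ T₁ z ≠ 0 ∧ Γ.dist x z + 1 = i then (1 : ℝ) else 0) *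
        ((s + 1) * v i) := by
    intro C hC
    simp only [Finset.mem_filter, Finset.mem_univ, true_and] at hC
    by_cases hne : ∃ z ∈ C, Γ.dist x z + 1 = i
    · obtain ⟨z, hzC, hz⟩ := hne
      have hd : ∀ u ∈ C, Γ.dist x u + 1 = i ∨ Γ.dist x u = i := fun u hu => by
        have := hp.dist_mem hC.1 hC.2 hzC hu (hi.symm.trans hz.symm) rfl
        omega
      obtain ⟨w, hwC, hwy, hfw, h0⟩ := hT.exists_mem hC.1 hC.2 hy
      have hwd : Γ.dist x w + 1 = i := (hd w hwC).resolve_right (ha.dist_ne hx hy hfw)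
      have hw0 : bitradeFun T₀ T₁ w ≠ 0 := by rw [hfw]; exact neg_ne_zero.2 hy
      have s2 : (∑ z ∈ C.erase y,
          if bitradeFun T₀ T₁ z ≠ 0 ∧ Γ.dist x z + 1 = i then (1 : ℝ) else 0) = 1 := by
        rw [Finset.sum_eq_single_of_mem w (Finset.mem_erase.2 ⟨hwy, hwC⟩), if_pos ⟨hw0, hwd⟩]
        intro u hu huw
        exact if_neg fun h => h.1 (h0 u (Finset.mem_of_mem_erase hu) (Finset.ne_of_mem_erase hu) huw)
      have s1 := hp.sum_clique_eq_zero (hA.isEigenfunction_of_isRadial hv x) hθ hC.1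
      have s3 : ∀ u ∈ C, v (Γ.dist x u) =
          v i - (if Γ.dist x u + 1 = i then 1 else 0) * (v i - v (i - 1)) := by
        intro u hu
        rcases hd u hu with h | h
        · rw [if_pos h, show i - 1 = Γ.dist x u by omega]; ring
        · rw [if_neg (by omega), h]; ring
      -- With n inner vertices in `C`, the zero sum reads (s + 1) v_i = n (v_i - v_{i-1}).
      rw [Finset.sum_congr rfl s3, Finset.sum_sub_distrib, ← Finset.sum_mul, Finset.sum_const,
        (hp.isNClique C hC.1).card_eq, nsmul_eq_mul, ← Finset.add_sum_erase C _ hC.2,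
        if_neg (by omega), zero_add] at s1
      rw [s2, one_mul]
      push_cast at s1
      linarith
    · push Not at hne
      rw [Finset.sum_eq_zero, Finset.sum_eq_zero, zero_mul, zero_mul]
      · exact fun z hz => if_neg fun h => hne z (Finset.mem_of_mem_erase hz) h.2
      · exact fun z hz => if_neg fun h => hne z (Finset.mem_of_mem_erase hz) h
  have h3 := Finset.sum_congr rfl key
  rw [← Finset.sum_mul, ← Finset.sum_mul, h1, h2] at h3
  refine mul_left_cancel₀ hm ?_
  linarith

theorem IsBitrade.card_adj_dist_succ (hT : IsBitrade S T₀ T₁) (hp : Γ.IsCliquePair k s m S)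
    (hf : Γ.IsEigenfunction (bitradeFun T₀ T₁) θ)
    (ha : Γ.AlternatesOnSpheres (bitradeFun T₀ T₁))
    (hx : bitradeFun T₀ T₁ x ≠ 0) (hy : bitradeFun T₀ T₁ y ≠ 0) :
    (({z | Γ.Adj y z ∧ bitradeFun T₀ T₁ z ≠ 0 ∧ Γ.dist x z = Γ.dist x y + 1} : Finset V).card : ℝ) +
      ({z | Γ.Adj y z ∧ bitradeFun T₀ T₁ z ≠ 0 ∧ Γ.dist x z + 1 = Γ.dist x y} : Finset V).card =
      -θ := by
  rw [← hT.card_adj hp hf hy, ← Nat.cast_add, Nat.cast_inj, ← Finset.card_union_of_disjoint]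
  · congr 1
    ext z
    simp only [Finset.mem_union, Finset.mem_filter, Finset.mem_univ, true_and]
    refine ⟨fun h => h.elim (fun h => ⟨h.1, h.2.1⟩) fun h => ⟨h.1, h.2.1⟩, fun ⟨h1, h2⟩ => ?_⟩
    have h3 := ha.dist_ne hx hy (hT.eq_neg_of_adj hp h1 hy h2)
    rcases h1.dist_cases x with h | h | h
    · exact .inl ⟨h1, h2, h⟩
    · exact absurd h h3
    · exact .inr ⟨h1, h2, h⟩
  · rw [Finset.disjoint_left]
    intro z h1 h2
    simp at h1 h2
    omega

end Counts

/-- `A'` is the array that `A` and the minimum eigenvalue `θ` determine for the subgraphs induced by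
the bitrades that meet the weight distribution bound. -/
def _root_.IntersectionArray.IsTradeArray {D : ℕ} (A A' : IntersectionArray D) (θ : ℝ) : Prop :=
  ∃ (v : ℕ → ℝ) (s : ℕ), A.bAt 0 + s * θ = 0 ∧ A.IsRadial θ v ∧ (∀ i ≤ D, v i ≠ 0) ∧
    (∀ i ≤ D, A.cAt i * (v i - v (i - 1)) = (s + 1) * v i * A'.cAt i) ∧
    ∀ i ≤ D, (A'.bAt i : ℝ) + A'.cAt i = -θ

end SimpleGraph

/-! ### From bitrades to isometric subgraphs and back. -/

namespace SimpleGraph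

variable {V : Type*}

theorem HasIntersectionArray.isTradeArray_unique [Fintype V] {Γ : SimpleGraph V} {D : ℕ}
    {A A' A'' : IntersectionArray D} {θ : ℝ} (hA : Γ.HasIntersectionArray A) (hθ : θ ≠ 0)
    (h' : A.IsTradeArray A' θ) (h'' : A.IsTradeArray A'' θ) : A' = A'' := by
  obtain ⟨v, s, hs, hv, hv0, hc, hb⟩ := h'
  obtain ⟨w, t, ht, hw, -, hc', hb'⟩ := h''
  have hst : (s : ℝ) = t := mul_right_cancel₀ hθ (by linarith)
  have hcc : ∀ i ≤ D, A'.cAt i = A''.cAt i := by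
    intro i hi
    have h1 := hc i hi
    have h2 := hc' i hi
    rw [← hA.isRadial_unique hv hw hi, ← hA.isRadial_unique hv hw (i.sub_le 1 |>.trans hi), h1,
      ← hst] at h2
    have hs1 : (s : ℝ) + 1 ≠ 0 := by positivity
    exact_mod_cast mul_left_cancel₀ (mul_ne_zero hs1 (hv0 i hi)) h2
  have hbb : ∀ i ≤ D, A'.bAt i = A''.bAt i := by
    intro i hi
    have h1 := hb i hi
    rw [hcc i hi, ← hb' i hi] at h1
    exact_mod_cast add_right_cancel h1
  ext i
  · simpa [IntersectionArray.bAt] using hbb i i.2.le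
  · simpa [IntersectionArray.cAt] using hcc (i + 1) i.2

/-- A set in which every vertex has a neighbour closer to any other given vertex induces an isometric
subgraph. -/
theorem Connected.isIsometricSubgraph_induce {Γ : SimpleGraph V} (hΓ : Γ.Connected) {T : Set V}
    (hT : T.Nonempty) (h : ∀ x ∈ T, ∀ y ∈ T, ∀ n, Γ.dist x y = n + 1 →
      ∃ z ∈ T, Γ.Adj y z ∧ Γ.dist x z = n) :
    Γ.IsIsometricSubgraph ((⊤ : Γ.Subgraph).induce T) := by
  set H := (⊤ : Γ.Subgraph).induce T
  have key : ∀ n, ∀ x y : H.verts, Γ.dist (x : V) y = n → ∃ p : H.coe.Walk y x, p.length = n := by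
    intro n
    induction n with
    | zero =>
      intro x y hxy
      obtain rfl : x = y := Subtype.ext (hΓ.dist_eq_zero_iff.1 hxy)
      exact ⟨.nil, rfl⟩
    | succ n ih =>
      intro x y hxy
      obtain ⟨z, hz, hyz, hxz⟩ := h x x.2 y y.2 n hxy
      obtain ⟨p, hp⟩ := ih x ⟨z, hz⟩ hxz
      have hadj : H.coe.Adj y ⟨z, hz⟩ := ⟨y.2, hz, hyz⟩
      exact ⟨.cons hadj p, by rw [Walk.length_cons, hp]⟩
  have hconn : H.coe.Connected := by
    have : Nonempty H.verts := hT.to_subtype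
    exact ⟨fun x y => (key _ y x rfl).elim fun p _ => p.reachable⟩
  refine ⟨hconn, fun x y => le_antisymm ?_ ?_⟩
  · obtain ⟨p, hp⟩ := key _ x y rfl
    rw [← hp, dist_comm]
    exact dist_le p
  · obtain ⟨p, hp⟩ := hconn.exists_walk_length_eq_dist x y
    rw [← hp, ← Walk.length_map H.hom p]
    exact dist_le _

section Fintype

variable [Fintype V] [Nontrivial V] {Γ : SimpleGraph V} {D : ℕ} {A : IntersectionArray D} {θ : ℝ}
  {k s m : ℕ} {S : Set (Finset V)}

theorem IsBitrade.exists_isometricSubgraph {T₀ T₁ : Set V} (hT : IsBitrade S T₀ T₁)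
    (hp : Γ.IsCliquePair k s m S) (hA : Γ.HasIntersectionArray A) (hθ : k + s * θ = 0)
    (hf : Γ.IsEigenfunction (bitradeFun T₀ T₁) θ)
    (ha : Γ.AlternatesOnSpheres (bitradeFun T₀ T₁)) :
    ∃ A' : IntersectionArray D, A.IsTradeArray A' θ ∧
      ∃ H : Γ.Subgraph, Γ.IsIsometricSubgraph H ∧ H.coe.HasIntersectionArray A' := by
  classical
  obtain ⟨v, hv⟩ := hA.exists_isRadial hf
  have hv0 : ∀ i ≤ D, v i ≠ 0 := fun i hi h0 => by
    have := hp.alternating hA hθ hv hi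
    simp [h0] at this
  have hs1 : (s : ℝ) + 1 ≠ 0 := by positivity
  set f := bitradeFun T₀ T₁ with hfdef
  obtain ⟨x₀, hx₀⟩ := Function.ne_iff.1 hf.1
  -- A reference nonzero at each distance from `x₀`, with a dummy beyond D; its counts will define
  -- the array.
  have hex : ∀ i, ∃ y, f y ≠ 0 ∧ (i ≤ D → Γ.dist x₀ y = i) := fun i => by
    by_cases hi : i ≤ D
    · obtain ⟨y, hy, hd⟩ := hA.exists_ne_zero_dist_eq hp hθ hf hx₀ hi
      exact ⟨y, hy, fun _ => hd⟩
    · exact ⟨x₀, hx₀, fun h => absurd h hi⟩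
  choose w hw hwd using hex
  let Nd : V → V → Finset V := fun x y => {z | Γ.Adj y z ∧ f z ≠ 0 ∧ Γ.dist x z + 1 = Γ.dist x y}
  let Nu : V → V → Finset V := fun x y => {z | Γ.Adj y z ∧ f z ≠ 0 ∧ Γ.dist x z = Γ.dist x y + 1}
  have hNd : ∀ x y, f x ≠ 0 → f y ≠ 0 → _ = (s + 1) * v (Γ.dist x y) * (Nd x y).card :=
    fun x y hx hy => hT.card_adj_dist_pred hp hA hθ ha hv hx hy
  have hNu : ∀ x y, f x ≠ 0 → f y ≠ 0 → ((Nu x y).card : ℝ) + (Nd x y).card = -θ :=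
    fun x y hx hy => hT.card_adj_dist_succ hp hf ha hx hy
  have hNd' : ∀ x y, f x ≠ 0 → f y ≠ 0 → (Nd x y).card = (Nd x₀ (w (Γ.dist x y))).card := by
    intro x y hx hy
    have hiD := hA.dist_le x y
    have h1 := hNd x y hx hy
    have h2 := hNd x₀ (w (Γ.dist x y)) hx₀ (hw _)
    rw [hwd _ hiD, h1] at h2
    exact_mod_cast mul_left_cancel₀ (mul_ne_zero hs1 (hv0 _ hiD)) h2
  have hNu' : ∀ x y, f x ≠ 0 → f y ≠ 0 → (Nu x y).card = (Nu x₀ (w (Γ.dist x y))).card := by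
    intro x y hx hy
    have h1 := (hNu x y hx hy).trans (hNu x₀ (w (Γ.dist x y)) hx₀ (hw _)).symm
    rw [hNd' x y hx hy] at h1
    exact_mod_cast add_right_cancel h1
  let A' : IntersectionArray D :=
    ⟨fun i => (Nu x₀ (w i)).card, fun i => (Nd x₀ (w (i + 1))).card⟩
  have hcAt : ∀ x y, f x ≠ 0 → f y ≠ 0 → (Nd x y).card = A'.cAt (Γ.dist x y) := by
    intro x y hx hy
    have hiD := hA.dist_le x y
    rcases Nat.eq_zero_or_pos (Γ.dist x y) with h0 | hpos
    · rw [h0, HasIntersectionArray.cAt_zero, Finset.card_eq_zero]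
      refine Finset.filter_eq_empty_iff.2 fun z _ hz => ?_
      omega
    · rw [hNd' x y hx hy, IntersectionArray.cAt, dif_pos ⟨hpos, hiD⟩]
      change _ = (Nd x₀ (w (Γ.dist x y - 1 + 1))).card
      rw [Nat.sub_add_cancel hpos]
  have hbAt : ∀ x y, f x ≠ 0 → f y ≠ 0 → (Nu x y).card = A'.bAt (Γ.dist x y) := by
    intro x y hx hy
    rcases (hA.dist_le x y).lt_or_eq with hlt | heq
    · rw [hNu' x y hx hy, IntersectionArray.bAt, dif_pos hlt]
    · rw [heq, HasIntersectionArray.bAt_top, Finset.card_eq_zero]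
      refine Finset.filter_eq_empty_iff.2 fun z _ hz => ?_
      have := hA.dist_le x z
      omega
  refine ⟨A', ⟨v, s, by rw [hp.bAt_zero_eq hA, hθ], hv, hv0, fun i hi => ?_, fun i hi => ?_⟩, ?_⟩
  · have := hNd x₀ (w i) hx₀ (hw i)
    rwa [hcAt _ _ hx₀ (hw i), hwd i hi] at this
  · have := hNu x₀ (w i) hx₀ (hw i)
    rwa [hcAt _ _ hx₀ (hw i), hbAt _ _ hx₀ (hw i), hwd i hi] at this
  have hiso : Γ.IsIsometricSubgraph ((⊤ : Γ.Subgraph).induce (Function.support f)) := by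
    refine hA.connected.isIsometricSubgraph_induce ⟨x₀, hx₀⟩ fun x hx y hy n hn => ?_
    obtain ⟨z, hyz, hz, hxz⟩ := hT.exists_adj_dist_pred hp ha hn hx hy
    exact ⟨z, hz, hyz, hxz⟩
  refine ⟨_, hiso, ⟨hiso.1, fun x => ?_, fun x => ?_, ?_, ?_⟩⟩
  · obtain ⟨y, hy, hd⟩ := hA.exists_ne_zero_dist_eq hp hθ hf x.2 le_rfl
    exact ⟨⟨y, hy⟩, (hiso.2 _ _).trans hd⟩
  · refine Set.eq_empty_of_forall_notMem fun y hy => ?_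
    have h1 : Γ.dist (x : V) y = D + 1 := (hiso.2 _ _).symm.trans hy
    have := hA.dist_le (x : V) y
    omega
  · rintro x i - y hy
    have hi : Γ.dist (x : V) y = i := (hiso.2 _ _).symm.trans hy
    rw [← hi, ← hbAt x y x.2 y.2, ← Set.encard_coe_eq_coe_finsetCard,
      ← Subtype.val_injective.encard_image]
    congr 1
    ext z
    simp only [Set.mem_image, Set.mem_inter_iff, distSphere, Set.mem_ofPred_eq, mem_neighborSet,
      Finset.coe_filter, Finset.mem_univ, true_and, Nu, hiso.2, hi]
    constructor
    · rintro ⟨z, ⟨h1, h2⟩, rfl⟩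
      exact ⟨h2.2.2, z.2, h1⟩
    · rintro ⟨h1, h2, h3⟩
      exact ⟨⟨z, h2⟩, ⟨h3, y.2, h2, h1⟩, rfl⟩
  · rintro x i - y hy
    have hi : Γ.dist (x : V) y = i := (hiso.2 _ _).symm.trans hy
    rw [← hi, ← hcAt x y x.2 y.2, ← Set.encard_coe_eq_coe_finsetCard,
      ← Subtype.val_injective.encard_image]
    congr 1
    ext z
    simp only [Set.mem_image, Set.mem_inter_iff, Set.mem_ofPred_eq, mem_neighborSet,
      Finset.coe_filter, Finset.mem_univ, true_and, Nd, hiso.2, hi]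
    constructor
    · rintro ⟨z, ⟨h1, h2⟩, rfl⟩
      exact ⟨h2.2.2, z.2, h1⟩
    · rintro ⟨h1, h2, h3⟩
      exact ⟨⟨z, h2⟩, ⟨h3, y.2, h2, h1⟩, rfl⟩

open scoped Classical in
/-- A set that induces a subgraph of degree `-θ` without edges inside the spheres around `x`
is split by the parity of the distance from `x` into a bitrade. -/
theorem IsCliquePair.isBitrade_parity (hp : Γ.IsCliquePair k s m S) (hθ : k + s * θ = 0)
    {T : Set V} {x : V} (hx : x ∈ T)
    (hdeg : ∀ y ∈ T, (({z | Γ.Adj y z ∧ z ∈ T} : Finset V).card : ℝ) = -θ)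
    (hbip : ∀ y ∈ T, ∀ z ∈ T, Γ.Adj y z → Γ.dist x z ≠ Γ.dist x y) :
    IsBitrade S {y ∈ T | Even (Γ.dist x y)} {y ∈ T | ¬ Even (Γ.dist x y)} := by
  have hpar : ∀ y ∈ T, ∀ z ∈ T, Γ.Adj y z → (Even (Γ.dist x z) ↔ ¬ Even (Γ.dist x y)) := by
    intro y hy z hz hyz
    rcases hyz.dist_cases x with h | h | h
    · rw [h, Nat.even_add_one]
    · exact absurd h (hbip y hy z hz hyz)
    · rw [← h, Nat.even_add_one, not_not]
  have huniq : ∀ C ∈ S, ∀ y ∈ C, y ∈ T → ∀ z ∈ C, z ∈ T →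
      (Even (Γ.dist x y) ↔ Even (Γ.dist x z)) → y = z := by
    intro C hC y hy hyT z hz hzT h
    by_contra hne
    have := hpar y hyT z hzT (hp.adj_of_mem hC hy hz hne)
    tauto
  -- There are -mθ cliques through `y`, each with at most one further vertex of `T` by parity. The
  -- neighbours of `y` in `T` give -mθ incidences in all, so each clique has exactly one.
  have hpartner : ∀ C ∈ S, ∀ y ∈ C, y ∈ T → ∃ z ∈ C, z ≠ y ∧ z ∈ T := by
    intro C hC y hy hyT
    have h1 := hp.sum_sum_erase (fun z => if z ∈ T then 1 else 0) y
    rw [← Finset.sum_filter, Finset.filter_filter, Finset.sum_const, nsmul_one, hdeg y hyT] at h1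
    have h2 := hp.card_cliques y
    have hs : (s : ℝ) ≠ 0 := by exact_mod_cast hp.s_pos.ne'
    have h3 : (({C | C ∈ S ∧ y ∈ C} : Finset (Finset V)).card : ℝ) = m * -θ :=
      mul_left_cancel₀ hs (by linear_combination h2 + m * hθ)
    rw [← h3, ← nsmul_one, ← Finset.sum_const] at h1
    have h4 : ∀ C ∈ ({C | C ∈ S ∧ y ∈ C} : Finset (Finset V)),
        (∑ z ∈ C.erase y, if z ∈ T then (1 : ℝ) else 0) ≤ 1 := by
      intro C hC
      simp only [Finset.mem_filter, Finset.mem_univ, true_and] at hC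
      rw [← Finset.sum_filter, Finset.sum_const, nsmul_one]
      norm_cast
      refine Finset.card_le_one.2 fun z hz u hu => ?_
      simp only [Finset.mem_filter, Finset.mem_erase] at hz hu
      have hz' := hpar y hyT z hz.2 (hp.adj_of_mem hC.1 hC.2 hz.1.2 hz.1.1.symm)
      have hu' := hpar y hyT u hu.2 (hp.adj_of_mem hC.1 hC.2 hu.1.2 hu.1.1.symm)
      exact huniq C hC.1 z hz.1.2 hz.2 u hu.1.2 hu.2 (hz'.trans hu'.symm)
    have h5 := (Finset.sum_eq_sum_iff_of_le h4).1 h1 C (by simp [hC, hy])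
    obtain ⟨z, hz, hz'⟩ := Finset.exists_ne_zero_of_sum_ne_zero (h5.trans_ne one_ne_zero)
    exact ⟨z, Finset.mem_of_mem_erase hz, Finset.ne_of_mem_erase hz, by simpa using hz'⟩
  refine ⟨⟨x, hx, by simp⟩, ?_, ?_, fun C hC => ?_⟩
  · have h1 := hdeg x hx
    have hneg := hp.neg_of_eq_zero hθ
    have h2 : 0 < ({z | Γ.Adj x z ∧ z ∈ T} : Finset V).card := by
      have : (0 : ℝ) < -θ := by linarith
      rw [← h1] at this
      exact_mod_cast this
    obtain ⟨z, hz⟩ := Finset.card_pos.1 h2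
    simp only [Finset.mem_filter, Finset.mem_univ, true_and] at hz
    refine ⟨z, hz.2, ?_⟩
    rw [hpar x hx z hz.2 hz.1]
    simp
  · exact Set.disjoint_left.2 fun y h1 h2 => h2.2 h1.2
  · by_cases hCT : ∃ y ∈ C, y ∈ T
    · left
      obtain ⟨y, hy, hyT⟩ := hCT
      obtain ⟨z, hz, hzy, hzT⟩ := hpartner C hC y hy hyT
      have hyz := hpar y hyT z hzT (hp.adj_of_mem hC hy hz hzy.symm)
      have hE : ∃ p ∈ C, p ∈ T ∧ Even (Γ.dist x p) := by
        by_cases h : Even (Γ.dist x y)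
        · exact ⟨y, hy, hyT, h⟩
        · exact ⟨z, hz, hzT, hyz.2 h⟩
      have hO : ∃ p ∈ C, p ∈ T ∧ ¬ Even (Γ.dist x p) := by
        by_cases h : Even (Γ.dist x y)
        · exact ⟨z, hz, hzT, fun h' => hyz.1 h' h⟩
        · exact ⟨y, hy, hyT, h⟩
      obtain ⟨p, hpC, hpT, hpE⟩ := hE
      obtain ⟨q, hqC, hqT, hqO⟩ := hO
      exact ⟨⟨p, ⟨hpC, hpT, hpE⟩, fun u hu =>
          huniq C hC u hu.1 hu.2.1 p hpC hpT (iff_of_true hu.2.2 hpE)⟩,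
        q, ⟨hqC, hqT, hqO⟩, fun u hu =>
          huniq C hC u hu.1 hu.2.1 q hqC hqT (iff_of_false hu.2.2 hqO)⟩
    · right
      push Not at hCT
      exact ⟨Set.disjoint_left.2 fun y hy h => hCT y hy h.1,
        Set.disjoint_left.2 fun y hy h => hCT y hy h.1⟩

theorem IsIsometricSubgraph.exists_bitrade {A' : IntersectionArray D} {H : Γ.Subgraph}
    (hH : Γ.IsIsometricSubgraph H) (hA' : H.coe.HasIntersectionArray A')
    (hbc : ∀ i ≤ D, (A'.bAt i : ℝ) + A'.cAt i = -θ) (hp : Γ.IsCliquePair k s m S)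
    (hA : Γ.HasIntersectionArray A) (hθ : k + s * θ = 0) :
    ∃ T₀ T₁ : Set V, IsBitrade S T₀ T₁ ∧ Γ.MeetsWDBound A (bitradeFun T₀ T₁) := by
  classical
  have : Fintype H.verts := Fintype.ofFinite _
  have hb0 : (A'.bAt 0 : ℝ) = -θ := by
    simpa [HasIntersectionArray.cAt_zero] using hbc 0 (Nat.zero_le _)
  have hadj : ∀ y z : H.verts, Γ.Adj (y : V) z ↔ H.coe.Adj y z := fun y z => by
    rw [← dist_eq_one_iff_adj, ← dist_eq_one_iff_adj, hH.2]
  obtain ⟨x⟩ := hH.1.nonempty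
  -- The degree in `H` is b'_0 = -θ = b'_i + c'_i, so a'_i = 0.
  have hbip : ∀ y ∈ H.verts, ∀ z ∈ H.verts, Γ.Adj y z → Γ.dist (x : V) z ≠ Γ.dist (x : V) y := by
    intro y hy z hz hyz hd
    have h1 := hA'.sum_adj_dist (fun j => if j = H.coe.dist x ⟨y, hy⟩ then 1 else 0) x ⟨y, hy⟩
    have hc0 : (A'.cAt (H.coe.dist x ⟨y, hy⟩) : ℝ) *
        (if H.coe.dist x ⟨y, hy⟩ - 1 = H.coe.dist x ⟨y, hy⟩ then 1 else 0) = 0 := by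
      rcases Nat.eq_zero_or_pos (H.coe.dist x ⟨y, hy⟩) with h0 | hpos
      · rw [h0, HasIntersectionArray.cAt_zero]; simp
      · rw [if_neg (by omega), mul_zero]
    have ha0 : A'.aAt (H.coe.dist x ⟨y, hy⟩) = 0 := by
      rw [IntersectionArray.aAt, hb0, ← hbc _ (hA'.dist_le x ⟨y, hy⟩)]
      ring
    rw [hc0, ha0] at h1
    simp only [Nat.add_eq_left, one_ne_zero, if_false, mul_zero, zero_mul, add_zero] at h1
    rw [Finset.sum_eq_zero_iff_of_nonneg fun z _ => by split_ifs <;> norm_num] at h1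
    have h2 := h1 ⟨z, hz⟩ (by simpa using (hadj ⟨y, hy⟩ ⟨z, hz⟩).1 hyz)
    rw [hH.2, hH.2, if_pos hd] at h2
    exact one_ne_zero h2
  have hdeg : ∀ y ∈ H.verts, (({z | Γ.Adj y z ∧ z ∈ H.verts} : Finset V).card : ℝ) = -θ := by
    intro y hy
    rw [← hb0, ← hA'.card_adj ⟨y, hy⟩, ← Finset.card_map (Function.Embedding.subtype _)]
    congr 2
    ext z
    simp only [Finset.mem_filter, Finset.mem_univ, true_and, Finset.mem_map,
      Function.Embedding.coe_subtype]
    constructor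
    · rintro ⟨h1, h2⟩
      exact ⟨⟨z, h2⟩, (hadj ⟨y, hy⟩ ⟨z, h2⟩).1 h1, rfl⟩
    · rintro ⟨z, h1, rfl⟩
      exact ⟨(hadj ⟨y, hy⟩ z).2 h1, z.2⟩
  have hT := hp.isBitrade_parity hθ x.2 hdeg hbip
  refine ⟨_, _, hT, θ, ?_⟩
  have hf := hp.isEigenfunction hT.bitradeFun_ne_zero (fun C hC => hT.sum_eq_zero hC) hθ
  refine ⟨hf, ?_⟩
  have hfx := bitradeFun_of_mem_left hT.disjoint
    (show (x : V) ∈ {y ∈ H.verts | Even (Γ.dist (x : V) y)} from ⟨x.2, by simp⟩)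
  rw [← sum_abs_eq_ncard_support fun y hy => abs_bitradeFun hT.disjoint hy,
    ← hA.sum_sphereSum _ (x : V)]
  refine Finset.sum_congr rfl fun i hi => ?_
  have h1 := hA.sphereSum_eq_wdCoeff hf x (Nat.lt_succ_iff.1 (Finset.mem_range.1 hi))
  rw [hfx, mul_one] at h1
  have h2 : ∀ y, bitradeFun {y ∈ H.verts | Even (Γ.dist (x : V) y)}
      {y ∈ H.verts | ¬ Even (Γ.dist (x : V) y)} y = (-1) ^ Γ.dist (x : V) y *
        |bitradeFun {y ∈ H.verts | Even (Γ.dist (x : V) y)}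
          {y ∈ H.verts | ¬ Even (Γ.dist (x : V) y)} y| := by
    intro y
    by_cases hy : y ∈ H.verts
    · by_cases he : Even (Γ.dist (x : V) y)
      · rw [bitradeFun_of_mem_left hT.disjoint ⟨hy, he⟩, he.neg_one_pow]; simp
      · rw [bitradeFun_of_mem_right hT.disjoint ⟨hy, he⟩,
          (Nat.not_even_iff_odd.1 he).neg_one_pow]; simp
    · rw [bitradeFun_of_notMem (fun h => hy h.1) fun h => hy h.1]; simp
  have h3 : Γ.sphereSum (bitradeFun {y ∈ H.verts | Even (Γ.dist (x : V) y)}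
      {y ∈ H.verts | ¬ Even (Γ.dist (x : V) y)}) x i = (-1) ^ i * Γ.sphereSum
        (fun y => |bitradeFun {y ∈ H.verts | Even (Γ.dist (x : V) y)}
          {y ∈ H.verts | ¬ Even (Γ.dist (x : V) y)} y|) x i := by
    rw [sphereSum, sphereSum, Finset.mul_sum]
    refine Finset.sum_congr rfl fun y hy => ?_
    rw [h2 y, abs_mul, abs_pow, abs_neg, abs_one, one_pow, one_mul, abs_abs,
      (Finset.mem_filter.1 hy).2]
  rw [← h1, h3, abs_mul, abs_pow, abs_neg, abs_one, one_pow, one_mul, abs_of_nonneg]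
  exact Finset.sum_nonneg fun _ _ => abs_nonneg _

/-- A clique bitrade that meets the weight distribution bound yields its array, its isometric
subgraph, and the minimum eigenvalue. -/
theorem exists_isTradeArray (hA : Γ.HasIntersectionArray A)
    (h : ∃ T₀ T₁ : Set V, Γ.IsCliqueBitrade T₀ T₁ ∧ Γ.MeetsWDBound A (bitradeFun T₀ T₁)) :
    ∃ (A' : IntersectionArray D) (θ : ℝ), Γ.IsMinEigenvalue θ ∧ θ < 0 ∧ A.IsTradeArray A' θ ∧
      ∃ H : Γ.Subgraph, Γ.IsIsometricSubgraph H ∧ H.coe.HasIntersectionArray A' := by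
  obtain ⟨T₀, T₁, ⟨k, s, m, S, hp, hT⟩, μ, hμ, hcard⟩ := h
  have hs : (s : ℝ) ≠ 0 := by exact_mod_cast hp.s_pos.ne'
  -- Here θ = -k/s comes from the pair of the bitrade itself; vanishing clique sums make it the
  -- eigenvalue.
  have hθ : (k : ℝ) + s * (-k / s) = 0 := by field_simp; ring
  have hf := hp.isEigenfunction hT.bitradeFun_ne_zero (fun C hC => hT.sum_eq_zero hC) hθ
  rw [hμ.unique hf] at hcard
  have ha : Γ.AlternatesOnSpheres (bitradeFun T₀ T₁) := fun x y hx hy =>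
    hp.eq_of_meets hA hθ hf (fun y hy => abs_bitradeFun hT.disjoint hy) hcard hx hy
  obtain ⟨A', hA', hH⟩ := hT.exists_isometricSubgraph hp hA hθ hf ha
  exact ⟨A', _, hp.isMinEigenvalue hf hθ, hp.neg_of_eq_zero hθ, hA', hH⟩

end Fintype

end SimpleGraph

theorem mainTheorem5 {D : ℕ} (A : IntersectionArray D) :
    ∃ A' : IntersectionArray D,
      ∀ (V : Type u) [Fintype V] [Nontrivial V] (Γ : SimpleGraph V),
        Γ.HasIntersectionArray A →
        (∃ (k s m : ℕ) (S : Set (Finset V)), Γ.IsDelsartePair k s m S) →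
        ((∃ T₀ T₁ : Set V, Γ.IsCliqueBitrade T₀ T₁ ∧
            Γ.MeetsWDBound A (SimpleGraph.bitradeFun T₀ T₁)) ↔
          ∃ H : Γ.Subgraph, Γ.IsIsometricSubgraph H ∧ H.coe.HasIntersectionArray A') := by
  -- If some graph with array `A` has such a bitrade, its array is taken for `A'`.
  by_cases hex : ∃ (V : Type u) (_ : Fintype V) (_ : Nontrivial V) (Γ : SimpleGraph V),
      Γ.HasIntersectionArray A ∧ ∃ T₀ T₁ : Set V, Γ.IsCliqueBitrade T₀ T₁ ∧
        Γ.MeetsWDBound A (SimpleGraph.bitradeFun T₀ T₁)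
  · obtain ⟨V₀, _, _, Γ₀, hA₀, h₀⟩ := hex
    obtain ⟨A', θ, hmin, hneg, htr, -⟩ := SimpleGraph.exists_isTradeArray hA₀ h₀
    rw [hA₀.isMinEigenvalue_iff] at hmin
    refine ⟨A', fun V _ _ Γ hA ⟨k, s, m, S, hS⟩ => ⟨fun h => ?_, fun ⟨H, hH, hHA⟩ => ?_⟩⟩
    · obtain ⟨A'', μ, hmin', -, htr', hH⟩ := SimpleGraph.exists_isTradeArray hA h
      obtain rfl := (hA.isMinEigenvalue_iff.1 hmin').unique hmin
      rwa [hA.isTradeArray_unique hneg.ne htr htr']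
    -- The Delsarte pair supplies cliques with `k + s * μ = 0` at the minimum eigenvalue, which is
    -- the θ of the reference graph.
    · obtain ⟨μ, hmin', hμ⟩ := hS.exists_isMinEigenvalue
      obtain rfl := (hA.isMinEigenvalue_iff.1 hmin').unique hmin
      obtain ⟨-, -, -, -, -, -, hbc⟩ := htr
      obtain ⟨T₀, T₁, hT, hw⟩ := hH.exists_bitrade hHA hbc hS.isCliquePair hA hμ
      exact ⟨T₀, T₁, ⟨k, s, m, S, hS.isCliquePair, hT⟩, hw⟩
  -- The zero array belongs to no graph of diameter D ≥ 1, so both sides of the equivalence are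
  -- false.
  · refine ⟨⟨0, 0⟩, fun V _ _ Γ hA _ => ⟨fun h => absurd ⟨V, ‹_›, ‹_›, Γ, hA, h⟩ hex, ?_⟩⟩
    rintro ⟨H, -, hH⟩
    exfalso
    have hD : 0 < D := by
      obtain ⟨x, y, hxy⟩ := exists_pair_ne V
      exact (hA.connected.pos_dist_of_ne hxy).trans_le (hA.dist_le x y)
    have : Fintype H.verts := Fintype.ofFinite _
    have := hH.bAt_pos hD
    simp [IntersectionArray.bAt] at this
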